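/- Let $d,T\ge 1$ be integers, let $K\subseteq\mathbb R^d$ be compact, and let $\sigma:\mathbb R\to\mathbb R$ be continuous, bounded, injective, not a polynomial function, and such that $\sigma(0)=0$; $\sigma$ is applied to vectors entrywise. Let $\mu$ be a probability measure on $\mathbb R$ that is absolutely continuous with respect to Lebesgue measure and has full support. For $N\ge 1$, matrices $A_1,A_2^1,\dots,A_2^d\in\mathbb R^{N\times N}$ and vectors $\xi_1,\xi_2^1,\dots,\xi_2^d\in\mathbb R^N$, the randomised signature of $x=(x_1,\dots,x_T)\in(\mathbb R^d)^T$ is defined by $\mathrm{RS}_0(x)=0$ and $$\mathrm{RS}_t(x)=\mathrm{RS}_{t-1}(x)+\sigma\big(A_1\mathrm{RS}_{t-1}(x)+\xi_1\big)+\sum_{i=1}^d\sigma\big(A_2^i\,\mathrm{RS}_{t-1}(x)+\xi_2^i\big)\,x_t^i,\qquad t=1,\dots,T,$$ and $\Delta\mathrm{RS}_T(x):=\mathrm{RS}_T(x)-\mathrm{RS}_{T-1}(x)$. Sampling scheme with widths $M,M_1,\dots,M_d\ge 1$: let $N=M+M_1+\dots+M_d+Td$ and split $\mathbb R^N=\mathbb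 R^M\times\mathbb R^{M_1}\times\dots\times\mathbb R^{M_d}\times\mathbb R^{Td}$ into blocks numbered $0,1,\dots,d,d+1$. All blocks of $A_1,\xi_1,A_2^i,\xi_2^i$ vanish except the following. - $A_1$ has the block $A_1^{(1)}\in\mathbb R^{M\times Td}$ in position $(0,d+1)$ and the block $A_1^{(2)}=\begin{bmatrix}0_{d\times(T-1)d}&0_{d\times d}\\ U&0_{(T-1)d\times d}\end{bmatrix}\in\mathbb R^{Td\times Td}$ in position $(d+1,d+1)$, with $U\in\mathbb R^{(T-1)d\times(T-1)d}$ upper triangular. - $\xi_1$ has the block $\tilde\xi_1\in\mathbb R^M$ in position $0$. - $A_2^i$ has the block $\tilde A_2^i\in\mathbb R^{M_i\times Td}$ in position $(i,d+1)$. - $\xi_2^i$ has the block $\tilde\xi_2^i\in\mathbb R^{M_i}$ in position $i$ and the block $\alpha_i e_i$ in position $d+1$, with $\alpha_i\in\mathbb R$ and $e_i$ the $i$-th canonical basis vector of $\mathbb R^{Td}$. The entries of $A_1^{(1)},\tilde\xi_1,\tilde A_2^i,\tilde\xi_2^i$ ($i=1,\dots,d$), the entries of $U$ on and above its diagonal,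 and $\alpha_1,\dots,\alpha_d$ are jointly independent random variables on a probability space, each with distribution $\mu$. Proposition. Let $f:K^T\to\mathbb R$ be of the form $$f(x_1,\dots,x_T)=g(x_1,\dots,x_{T-1})+\sum_{i=1}^d h_i(x_1,\dots,x_{T-1})\,x_T^i$$ with continuous $g,h_1,\dots,h_d:K^{T-1}\to\mathbb R$. Then for every $\alpha\in(0,1)$ and $\varepsilon>0$ there are widths $M,M_1,\dots,M_d\ge1$ such that, under the sampling scheme with these widths, with probability greater than $\alpha$ there exist $\tilde w\in\mathbb R^M$ and $\tilde w_i\in\mathbb R^{M_i}$, $i=1,\dots,d$, for which the output vector $w=(\tilde w,\tilde w_1,\dots,\tilde w_d,0_{Td})\in\mathbb R^N$ satisfies $$\sup_{x_1,\dots,x_T\in K}\big|f(x_1,\dots,x_T)-\langle w,\Delta\mathrm{RS}_T(x_1,\dots,x_T)\rangle\big|<\varepsilon .$$ -/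

import Mathlib

open MeasureTheory ProbabilityTheory
open scoped Matrix

noncomputable section

namespace RandSig

/-- The randomised signature of a datastream `x : {1, …, T} → ℝ^d` (the value `x_{t+1}` is `x t`,
`t : Fin T`), as the sequence of its values at the times `0, 1, …, T`: it starts at `0` and satisfies
`RS_{t+1} = RS_t + σ(A₁ RS_t + ξ₁) + ∑ i, σ(A₂ⁱ RS_t + ξ₂ⁱ) x_{t+1}ⁱ`, where `σ` acts entrywise. -/
def randSig {ι : Type*} [Fintype ι] {T d : ℕ} (σ : ℝ → ℝ)
    (A₁ : Matrix ι ι ℝ) (ξ₁ : ι → ℝ) (A₂ : Fin d → Matrix ι ι ℝ) (ξ₂ : Fin d → ι → ℝ)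
    (x : Fin T → Fin d → ℝ) : Fin (T + 1) → ι → ℝ :=
  Fin.induction (motive := fun _ => ι → ℝ) 0 fun t RS j =>
    RS j + σ ((A₁ *ᵥ RS + ξ₁) j) + ∑ i, σ ((A₂ i *ᵥ RS + ξ₂ i) j) * x t i

/-- The terminal difference `RS_T(x) - RS_{T-1}(x)`, for the horizon `T = n + 1`. -/
def deltaRS {ι : Type*} [Fintype ι] {n d : ℕ} (σ : ℝ → ℝ)
    (A₁ : Matrix ι ι ℝ) (ξ₁ : ι → ℝ) (A₂ : Fin d → Matrix ι ι ℝ) (ξ₂ : Fin d → ι → ℝ)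
    (x : Fin (n + 1) → Fin d → ℝ) : ι → ℝ :=
  randSig σ A₁ ξ₁ A₂ ξ₂ x (Fin.last (n + 1)) - randSig σ A₁ ξ₁ A₂ ξ₂ x (Fin.last n).castSucc

/-- The assumption on the activation function. -/
structure IsAdmissibleActivation (σ : ℝ → ℝ) : Prop where
  continuous : Continuous σ
  bounded : ∃ C : ℝ, ∀ t, |σ t| ≤ C
  nonpolynomial : ¬ ∃ p : Polynomial ℝ, ∀ t, σ t = p.eval t
  injective : Function.Injective σ
  map_zero : σ 0 = 0

/-- The coordinates of the state space `ℝ^N`, `N = M + m₁ + ⋯ + m_d + T d`, in their blocks. In the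
last block, the coordinate `(k, i)` (both counted from `0`) is the coordinate number `k d + i` of
`ℝ^{T d}` (counted from `0`), so that the usual order of coordinates is the lexicographic one. -/
abbrev StateIdx (T d M : ℕ) (m : Fin d → ℕ) : Type :=
  Fin M ⊕ (Σ i : Fin d, Fin (m i)) ⊕ (Fin T × Fin d)

/-- Names of the random entries of the second sampling scheme, for the horizon `T = n + 1`: the
entries of `A₁⁽¹⁾`, `ξ̃₁`, `Ã₂ⁱ`, `ξ̃₂ⁱ`, the entries of the `(T-1)d × (T-1)d` matrix `U` on and above
the diagonal, and `α₁, …, α_d`. -/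
inductive HiddenIdx (n d M : ℕ) (m : Fin d → ℕ) : Type
  | A₁₁ (r : Fin M) (c : Fin (n + 1) × Fin d)
  | ξ₁ (r : Fin M)
  | A₂ (i : Fin d) (r : Fin (m i)) (c : Fin (n + 1) × Fin d)
  | ξ₂ (i : Fin d) (r : Fin (m i))
  | U (p q : Fin n × Fin d) (h : toLex p ≤ toLex q)
  | α (i : Fin d)

variable {n d M : ℕ} {m : Fin d → ℕ}

/-- The upper triangular matrix `U`. -/
def schemeU (z : HiddenIdx n d M m → ℝ) : Matrix (Fin n × Fin d) (Fin n × Fin d) ℝ :=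
  Matrix.of fun p q => if h : toLex p ≤ toLex q then z (.U p q h) else 0

/-- The matrix `A₁⁽²⁾ = [[0, 0], [U, 0]]`: its first `d` rows and its last `d` columns vanish. -/
def schemeA₁₂ (z : HiddenIdx n d M m → ℝ) :
    Matrix (Fin (n + 1) × Fin d) (Fin (n + 1) × Fin d) ℝ :=
  Matrix.of fun p q =>
    Fin.cases (motive := fun _ => ℝ) 0
      (fun k => Fin.lastCases (motive := fun _ => ℝ) 0
        (fun l => schemeU z (k, p.2) (l, q.2)) q.1) p.1

/-- The matrix `A₁`. -/
def schemeA₁ (z : HiddenIdx n d M m → ℝ) :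
    Matrix (StateIdx (n + 1) d M m) (StateIdx (n + 1) d M m) ℝ :=
  Matrix.of fun a b => match a, b with
    | .inl r, .inr (.inr c) => z (.A₁₁ r c)
    | .inr (.inr p), .inr (.inr q) => schemeA₁₂ z p q
    | _, _ => 0

/-- The vector `ξ₁`. -/
def schemeξ₁ (z : HiddenIdx n d M m → ℝ) : StateIdx (n + 1) d M m → ℝ
  | .inl r => z (.ξ₁ r)
  | .inr _ => 0

/-- The matrix `A₂ⁱ`. -/
def schemeA₂ (z : HiddenIdx n d M m → ℝ) (i : Fin d) :
    Matrix (StateIdx (n + 1) d M m) (StateIdx (n + 1) d M m) ℝ :=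
  Matrix.of fun a b => match a, b with
    | .inr (.inl s), .inr (.inr c) => if s.1 = i then z (.A₂ s.1 s.2 c) else 0
    | _, _ => 0

/-- The vector `ξ₂ⁱ`; its last block is `α_i e_i`. -/
def schemeξ₂ (z : HiddenIdx n d M m → ℝ) (i : Fin d) : StateIdx (n + 1) d M m → ℝ
  | .inl _ => 0
  | .inr (.inl s) => if s.1 = i then z (.ξ₂ s.1 s.2) else 0
  | .inr (.inr p) => if p = (0, i) then z (.α i) else 0

/-- The second sampling scheme: the random entries are i.i.d. with distribution `μ`. -/
structure IsSamplingScheme₂ {Ω : Type*} [MeasurableSpace Ω] (P : Measure Ω) (μ : Measure ℝ)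
    (ζ : HiddenIdx n d M m → Ω → ℝ) : Prop where
  measurable : ∀ e, Measurable (ζ e)
  indep : iIndepFun ζ P
  law : ∀ e, P.map (ζ e) = μ

/-- The terminal difference of the randomised signature of `x` whose hidden weights are built from
the entries `z` as the second sampling scheme prescribes. -/
def schemeDeltaRS (σ : ℝ → ℝ) (z : HiddenIdx n d M m → ℝ) (x : Fin (n + 1) → Fin d → ℝ) :
    StateIdx (n + 1) d M m → ℝ :=
  deltaRS σ (schemeA₁ z) (schemeξ₁ z) (schemeA₂ z) (schemeξ₂ z) x

/-- The output vector `w = (w̃, w̃₁, …, w̃_d, 0)`. -/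
def outputVec (T : ℕ) (w₀ : Fin M → ℝ) (w : (i : Fin d) → Fin (m i) → ℝ) :
    StateIdx T d M m → ℝ
  | .inl r => w₀ r
  | .inr (.inl s) => w s.1 s.2
  | .inr (.inr _) => 0

end RandSig

end

/-!
The terminal difference of the signature is linear in the last observation, and its coefficients are
neurons with independent random weights that read the last block of the state. That block evolves
by itself and encodes the past injectively: the rows of `A₁⁽²⁾` are triangular up to a shift with
nonzero diagonal almost surely, so each step can be inverted by back substitution.

A bounded continuous injective `σ` has two different limits at `±∞`, hence its dilations tend to a
step, and integrating translated steps against `exp` produces exponentials in the closed span of the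
neurons. These span a subalgebra that separates points, so neurons composed with an injective
continuous map are universal.

Up to small probability the parameters of the last block lie in a compact set that excludes zero
diagonal entries. By compactness finitely many open sets of neuron weights suffice for approximation
simultaneously for all these parameters, and many independent neurons meet all of these sets with
high probability.
-/

open Filter Topology

namespace RandSig

section Sigmoidal

/-- The step with value `l₀` on `(-∞, 0]` and `l₁` on `(0, ∞)`: the pointwise limit away from `0` of
the dilations `v ↦ σ (k v)` of a function `σ` with limits `l₀` at `-∞` and `l₁` at `∞`. -/
noncomputable def stepFun (l₀ l₁ v : ℝ) : ℝ := if 0 < v then l₁ else l₀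

variable {σ : ℝ → ℝ} {l₀ l₁ C : ℝ}

lemma exists_limits_of_continuous_injective_bounded (hσ : Continuous σ)
    (hinj : Function.Injective σ) (hC : ∀ t, |σ t| ≤ C) :
    ∃ l₀ l₁ : ℝ, l₀ ≠ l₁ ∧ Tendsto σ atBot (𝓝 l₀) ∧ Tendsto σ atTop (𝓝 l₁) := by
  have above : BddAbove (Set.range σ) := ⟨C, Set.forall_mem_range.2 fun t => (abs_le.1 (hC t)).2⟩
  have below : BddBelow (Set.range σ) := ⟨-C, Set.forall_mem_range.2 fun t => (abs_le.1 (hC t)).1⟩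
  rcases hσ.strictMono_of_inj hinj with mono | anti
  · refine ⟨⨅ t, σ t, ⨆ t, σ t, ne_of_lt ?_, tendsto_atBot_ciInf mono.monotone below,
      tendsto_atTop_ciSup mono.monotone above⟩
    exact (ciInf_le below 0).trans_lt ((mono one_pos).trans_le (le_ciSup above 1))
  · refine ⟨⨆ t, σ t, ⨅ t, σ t, ne_of_gt ?_, tendsto_atBot_ciSup anti.antitone above,
      tendsto_atTop_ciInf anti.antitone below⟩
    exact (ciInf_le below 1).trans_lt ((anti one_pos).trans_le (le_ciSup above 0))

lemma measurable_stepFun (l₀ l₁ : ℝ) : Measurable (stepFun l₀ l₁) :=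
  Measurable.ite measurableSet_Ioi measurable_const measurable_const

lemma abs_stepFun_le (l₀ l₁ v : ℝ) : |stepFun l₀ l₁ v| ≤ |l₀| + |l₁| := by
  unfold stepFun
  split_ifs <;> linarith [abs_nonneg l₀, abs_nonneg l₁]

lemma abs_comp_mul_sub_stepFun_le (hC : ∀ t, |σ t| ≤ C) (l₀ l₁ k v : ℝ) :
    |σ (k * v) - stepFun l₀ l₁ v| ≤ C + (|l₀| + |l₁|) :=
  (abs_sub _ _).trans (add_le_add (hC _) (abs_stepFun_le _ _ _))

lemma tendsto_comp_mul_stepFun (h₀ : Tendsto σ atBot (𝓝 l₀)) (h₁ : Tendsto σ atTop (𝓝 l₁))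
    {v : ℝ} (hv : v ≠ 0) : Tendsto (fun k => σ (k * v)) atTop (𝓝 (stepFun l₀ l₁ v)) := by
  unfold stepFun
  split_ifs with hpos
  · exact h₁.comp (tendsto_id.atTop_mul_const hpos)
  · exact h₀.comp (tendsto_id.atTop_mul_const_of_neg (lt_of_le_of_ne (not_lt.1 hpos) hv))

lemma intervalIntegrable_of_measurable_of_bounded {f : ℝ → ℝ} (hf : Measurable f)
    (hC : ∀ t, |f t| ≤ C) (a b : ℝ) : IntervalIntegrable f volume a b :=
  (intervalIntegrable_const (c := C)).mono_fun hf.aestronglyMeasurable <|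
    ae_of_all _ fun t => (hC t).trans (le_abs_self C)

lemma intervalIntegrable_mul_comp_sub_left {f ρ : ℝ → ℝ} (hf : Measurable f) (hC : ∀ t, |f t| ≤ C)
    (hρ : Continuous ρ) (t a b : ℝ) : IntervalIntegrable (fun s => ρ s * f (t - s)) volume a b :=
  (intervalIntegrable_of_measurable_of_bounded (hf.comp (measurable_const.sub measurable_id))
    (fun s => hC (t - s)) a b).continuousOn_mul hρ.continuousOn

lemma intervalIntegrable_abs_comp_mul_sub_stepFun (hσ : Measurable σ) (hC : ∀ t, |σ t| ≤ C)
    (l₀ l₁ k a b : ℝ) :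
    IntervalIntegrable (fun v => |σ (k * v) - stepFun l₀ l₁ v|) volume a b :=
  (intervalIntegrable_of_measurable_of_bounded
    ((hσ.comp (measurable_const_mul k)).sub (measurable_stepFun l₀ l₁))
    (abs_comp_mul_sub_stepFun_le hC l₀ l₁ k) a b).abs

lemma tendsto_integral_abs_comp_mul_sub_stepFun (hσ : Measurable σ) (hC : ∀ t, |σ t| ≤ C)
    (h₀ : Tendsto σ atBot (𝓝 l₀)) (h₁ : Tendsto σ atTop (𝓝 l₁)) (a b : ℝ) :
    Tendsto (fun k => ∫ v in a..b, |σ (k * v) - stepFun l₀ l₁ v|) atTop (𝓝 0) := by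
  rw [← intervalIntegral.integral_zero (a := a) (b := b) (μ := volume) (E := ℝ)]
  refine intervalIntegral.tendsto_integral_filter_of_dominated_convergence
    (fun _ => C + (|l₀| + |l₁|)) (.of_forall fun k => ?_) (.of_forall fun k => ?_)
    intervalIntegrable_const ?_
  · exact ((hσ.comp (measurable_const_mul k)).sub
      (measurable_stepFun l₀ l₁)).abs.aestronglyMeasurable
  · exact ae_of_all _ fun v _ => (abs_abs _).trans_le (abs_comp_mul_sub_stepFun_le hC l₀ l₁ k v)
  · have nonzero : ∀ᵐ v : ℝ, v ≠ 0 := by simp [ae_iff]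
    filter_upwards [nonzero] with v hv _
    simpa using ((tendsto_comp_mul_stepFun h₀ h₁ hv).sub_const (stepFun l₀ l₁ v)).abs

lemma abs_integral_mul_comp_sub_le {ρ : ℝ → ℝ} (hσ : Measurable σ) (hC : ∀ t, |σ t| ≤ C)
    (hρ : Continuous ρ) {a b B : ℝ} (hB : ∀ s ∈ Set.Icc a b, |ρ s| ≤ B) (l₀ l₁ k : ℝ) {t : ℝ}
    (ht : t ∈ Set.Icc a b) :
    |(∫ s in a..b, ρ s * σ (k * (t - s))) - ∫ s in a..b, ρ s * stepFun l₀ l₁ (t - s)| ≤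
      B * ∫ v in (a - b)..(b - a), |σ (k * v) - stepFun l₀ l₁ v| := by
  have hab : a ≤ b := ht.1.trans ht.2
  have hBnonneg : 0 ≤ B := (abs_nonneg _).trans (hB t ht)
  have defect := intervalIntegrable_abs_comp_mul_sub_stepFun hσ hC l₀ l₁ k
  have reflected : IntervalIntegrable (fun s => |σ (k * (t - s)) - stepFun l₀ l₁ (t - s)|)
      volume a b := by
    simpa using (defect (t - a) (t - b)).comp_sub_left t
  rw [← intervalIntegral.integral_sub
    (intervalIntegrable_mul_comp_sub_left (f := fun v => σ (k * v))
      (hσ.comp (measurable_const_mul k)) (fun v => hC (k * v)) hρ t a b)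
    (intervalIntegrable_mul_comp_sub_left (measurable_stepFun l₀ l₁) (abs_stepFun_le l₀ l₁) hρ
      t a b)]
  calc ‖∫ s in a..b, (ρ s * σ (k * (t - s)) - ρ s * stepFun l₀ l₁ (t - s))‖
      ≤ ∫ s in a..b, B * |σ (k * (t - s)) - stepFun l₀ l₁ (t - s)| := by
        refine intervalIntegral.norm_integral_le_of_norm_le hab (ae_of_all _ fun s hs => ?_)
          (reflected.const_mul B)
        rw [← mul_sub, Real.norm_eq_abs, abs_mul]
        exact mul_le_mul_of_nonneg_right (hB s (Set.Ioc_subset_Icc_self hs)) (abs_nonneg _)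
    _ = B * ∫ v in (t - b)..(t - a), |σ (k * v) - stepFun l₀ l₁ v| := by
        rw [intervalIntegral.integral_const_mul, intervalIntegral.integral_comp_sub_left
          fun v => |σ (k * v) - stepFun l₀ l₁ v|]
    _ ≤ _ := by
        refine mul_le_mul_of_nonneg_left (intervalIntegral.integral_mono_interval
          (by linarith [ht.1]) (by linarith) (by linarith [ht.2])
          (ae_of_all _ fun _ => abs_nonneg _) (defect _ _)) hBnonneg

lemma tendstoUniformlyOn_integral_mul_comp {ρ : ℝ → ℝ} (hσ : Measurable σ) (hC : ∀ t, |σ t| ≤ C)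
    (h₀ : Tendsto σ atBot (𝓝 l₀)) (h₁ : Tendsto σ atTop (𝓝 l₁)) (hρ : Continuous ρ) (a b : ℝ) :
    TendstoUniformlyOn (fun k t => ∫ s in a..b, ρ s * σ (k * (t - s)))
      (fun t => ∫ s in a..b, ρ s * stepFun l₀ l₁ (t - s)) atTop (Set.Icc a b) := by
  obtain ⟨B, hB⟩ := isCompact_Icc.exists_bound_of_continuousOn hρ.continuousOn (s := Set.Icc a b)
  have defect : Tendsto (fun k => B * ∫ v in (a - b)..(b - a), |σ (k * v) - stepFun l₀ l₁ v|)
      atTop (𝓝 0) := by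
    simpa using (tendsto_integral_abs_comp_mul_sub_stepFun hσ hC h₀ h₁ _ _).const_mul B
  refine Metric.tendstoUniformlyOn_iff.2 fun ε hε => ?_
  filter_upwards [defect.eventually_lt_const hε] with k hk t ht
  rw [dist_comm]
  exact (abs_integral_mul_comp_sub_le hσ hC hρ hB l₀ l₁ k ht).trans_lt hk

lemma integral_exp_mul_stepFun (l₀ l₁ : ℝ) {a b t : ℝ} (ht : t ∈ Set.Icc a b) :
    ∫ s in a..b, Real.exp s * stepFun l₀ l₁ (t - s) =
      (l₁ - l₀) * Real.exp t + (l₀ * Real.exp b - l₁ * Real.exp a) := by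
  have left : ∀ s ∈ Set.Ioo a t, Real.exp s * stepFun l₀ l₁ (t - s) = Real.exp s * l₁ := by
    intro s hs
    simp [stepFun, hs.2]
  have right : ∀ s ∈ Set.Ioo t b, Real.exp s * stepFun l₀ l₁ (t - s) = Real.exp s * l₀ := by
    intro s hs
    simp [stepFun, hs.1.le]
  have integrable := intervalIntegrable_mul_comp_sub_left (measurable_stepFun l₀ l₁)
    (abs_stepFun_le l₀ l₁) Real.continuous_exp t
  rw [← intervalIntegral.integral_add_adjacent_intervals (integrable a t) (integrable t b),
    intervalIntegral.integral_congr_Ioo_of_le ht.1 left,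
    intervalIntegral.integral_congr_Ioo_of_le ht.2 right, intervalIntegral.integral_mul_const,
    intervalIntegral.integral_mul_const, integral_exp, integral_exp]
  ring

end Sigmoidal

section UniversalApproximation

lemma intervalIntegral_mem_of_isClosed {E : Type*} [NormedAddCommGroup E] [NormedSpace ℝ E]
    [CompleteSpace E] {V : Submodule ℝ E} (hV : IsClosed (V : Set E)) {f : ℝ → E}
    (hf : Continuous f) (hmem : ∀ s, f s ∈ V) (a b : ℝ) : ∫ s in a..b, f s ∈ V := by
  have : CompleteSpace V := hV.completeSpace_coe
  have restricted : Continuous fun s => (⟨f s, hmem s⟩ : V) := hf.subtype_mk hmem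
  rw [show ∫ s in a..b, f s = V.subtypeL (∫ s in a..b, (⟨f s, hmem s⟩ : V)) from
    V.subtypeL.intervalIntegral_comp_comm (restricted.intervalIntegrable (μ := volume) a b)]
  exact Subtype.coe_prop _

lemma exists_apply_ne_zero_of_tendsto_ne {σ : ℝ → ℝ} {l₀ l₁ : ℝ} (hl : l₀ ≠ l₁)
    (h₀ : Tendsto σ atBot (𝓝 l₀)) (h₁ : Tendsto σ atTop (𝓝 l₁)) : ∃ b, σ b ≠ 0 := by
  by_contra! zero
  obtain rfl : σ = fun _ => 0 := funext zero
  exact hl ((tendsto_nhds_unique h₀ tendsto_const_nhds).trans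
    (tendsto_nhds_unique h₁ tendsto_const_nhds).symm)

variable {X : Type*} [TopologicalSpace X]

lemma const_mem_of_comp_const_mem {σ : C(ℝ, ℝ)} {V : Submodule ℝ C(X, ℝ)} {b : ℝ} (hb : σ b ≠ 0)
    (hmem : σ.comp (.const X b) ∈ V) (c : ℝ) : .const X c ∈ V := by
  convert V.smul_mem (c / σ b) hmem using 1
  ext x
  simp [hb]

variable [CompactSpace X] {ι : Type*} [Fintype ι]

lemma exp_comp_mem_of_comp_affine_mem {σ : C(ℝ, ℝ)} {C l₀ l₁ : ℝ} (hC : ∀ t, |σ t| ≤ C)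
    (hl : l₀ ≠ l₁) (h₀ : Tendsto σ atBot (𝓝 l₀)) (h₁ : Tendsto σ atTop (𝓝 l₁))
    {V : Submodule ℝ C(X, ℝ)} (hV : IsClosed (V : Set C(X, ℝ))) (u : C(X, ℝ))
    (hmem : ∀ a b : ℝ, σ.comp (a • u + .const X b) ∈ V) :
    (⟨Real.exp, Real.continuous_exp⟩ : C(ℝ, ℝ)).comp u ∈ V := by
  obtain ⟨b, hb⟩ := exists_apply_ne_zero_of_tendsto_ne hl h₀ h₁
  have const_mem : ∀ c, .const X c ∈ V :=
    const_mem_of_comp_const_mem hb (by simpa using hmem 0 b)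
  have range_mem : ∀ x, u x ∈ Set.Icc (-‖u‖) ‖u‖ := fun x => abs_le.1 (u.norm_coe_le_norm x)
  let integrand (k s : ℝ) : C(X, ℝ) := Real.exp s • σ.comp (k • u + .const X (-(k * s)))
  have continuous_integrand (k : ℝ) : Continuous (integrand k) :=
    ContinuousMap.continuous_of_continuous_uncurry _ (by
      simp only [integrand, Function.uncurry_def, ContinuousMap.smul_apply,
        ContinuousMap.comp_apply, ContinuousMap.add_apply, ContinuousMap.const_apply]
      fun_prop)
  let limit : C(X, ℝ) := (l₁ - l₀) • (⟨Real.exp, Real.continuous_exp⟩ : C(ℝ, ℝ)).comp u +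
    .const X (l₀ * Real.exp ‖u‖ - l₁ * Real.exp (-‖u‖))
  have tendsto_limit : Tendsto (fun k => ∫ s in (-‖u‖)..‖u‖, integrand k s) atTop (𝓝 limit) := by
    rw [ContinuousMap.tendsto_iff_tendstoUniformly, ← tendstoUniformlyOn_univ]
    refine (((tendstoUniformlyOn_integral_mul_comp σ.continuous.measurable hC h₀ h₁
      Real.continuous_exp (-‖u‖) ‖u‖).comp u).mono (s' := Set.univ)
        fun x _ => range_mem x).congr (.of_forall fun k x _ => ?_) |>.congr_right fun x _ => ?_
    · have eval := (ContinuousMap.evalCLM ℝ x).intervalIntegral_comp_comm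
        ((continuous_integrand k).intervalIntegrable (μ := volume) (-‖u‖) ‖u‖)
      simpa [integrand, mul_sub, ← sub_eq_add_neg] using eval
    · exact integral_exp_mul_stepFun l₀ l₁ (range_mem x)
  have limit_mem : limit ∈ V := hV.mem_of_tendsto tendsto_limit <| .of_forall fun k =>
    intervalIntegral_mem_of_isClosed hV (continuous_integrand k)
      (fun s => V.smul_mem _ (hmem k _)) _ _
  rwa [V.add_mem_iff_left (const_mem _), V.smul_mem_iff (sub_ne_zero.2 hl.symm)] at limit_mem

/-- The neuron `y ↦ σ (⟨a, y⟩ + b)` with weights `a = (v (some c))_c` and bias `b = v none`; weights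
and bias form one vector because they are one row of independent random entries. -/
def neuron (σ : C(ℝ, ℝ)) (v : Option ι → ℝ) : C(ι → ℝ, ℝ) where
  toFun y := σ (∑ c, v (some c) * y c + v none)

lemma continuous_neuron (σ : C(ℝ, ℝ)) : Continuous fun p : (Option ι → ℝ) × (ι → ℝ) =>
    neuron σ p.1 p.2 := by
  simp only [neuron, ContinuousMap.coe_mk]
  fun_prop

/-- The exponentials `x ↦ exp ⟨a, φ x⟩`, as a homomorphism from the additive group of the vectors
`a` to the multiplicative monoid of continuous functions. -/
noncomputable def expDotHom (φ : C(X, ι → ℝ)) : Multiplicative (ι → ℝ) →* C(X, ℝ) where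
  toFun a := ⟨fun x => Real.exp (∑ c, a.toAdd c * φ x c), by fun_prop⟩
  map_one' := by ext x; simp
  map_mul' a b := by ext x; simp [add_mul, Finset.sum_add_distrib, Real.exp_add]

lemma topologicalClosure_span_range_expDotHom_eq_top {φ : C(X, ι → ℝ)}
    (hφ : Function.Injective φ) :
    (Submodule.span ℝ (Set.range (expDotHom φ))).topologicalClosure = ⊤ := by
  classical
  have separates : (Algebra.adjoin ℝ (Set.range (expDotHom φ))).SeparatesPoints := by
    intro x y hxy
    obtain ⟨c, hc⟩ := Function.ne_iff.1 (hφ.ne hxy)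
    refine ⟨_, ⟨_, Algebra.subset_adjoin ⟨.ofAdd (Pi.single c 1), rfl⟩, rfl⟩, ?_⟩
    simpa [expDotHom, Pi.single_apply] using hc
  have adjoin_eq_span : Subalgebra.toSubmodule (Algebra.adjoin ℝ (Set.range (expDotHom φ))) =
      Submodule.span ℝ (Set.range (expDotHom φ)) := by
    rw [Algebra.adjoin_eq_span, ← MonoidHom.coe_mrange, Submonoid.closure_eq]
  rw [← adjoin_eq_span]
  exact congrArg Subalgebra.toSubmodule
    (ContinuousMap.subalgebra_topologicalClosure_eq_top_of_separatesPoints _ separates)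

theorem topologicalClosure_span_range_neuron_comp_eq_top {σ : C(ℝ, ℝ)} {C l₀ l₁ : ℝ}
    (hC : ∀ t, |σ t| ≤ C) (hl : l₀ ≠ l₁) (h₀ : Tendsto σ atBot (𝓝 l₀))
    (h₁ : Tendsto σ atTop (𝓝 l₁)) {φ : C(X, ι → ℝ)} (hφ : Function.Injective φ) :
    (Submodule.span ℝ (Set.range fun v => (neuron σ v).comp φ)).topologicalClosure = ⊤ := by
  set V := (Submodule.span ℝ (Set.range fun v => (neuron σ v).comp φ)).topologicalClosure
  have hV : IsClosed (V : Set C(X, ℝ)) := Submodule.isClosed_topologicalClosure _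
  have expDotHom_mem (a : Multiplicative (ι → ℝ)) : expDotHom φ a ∈ V := by
    refine exp_comp_mem_of_comp_affine_mem hC hl h₀ h₁ hV
      ⟨fun x => ∑ c, a.toAdd c * φ x c, by fun_prop⟩ fun r b => ?_
    refine Submodule.le_topologicalClosure _ (Submodule.subset_span
      ⟨fun o => o.elim b fun c => r * a.toAdd c, ?_⟩)
    ext x
    simp [neuron, Finset.mul_sum, mul_assoc]
  rw [eq_top_iff, ← topologicalClosure_span_range_expDotHom_eq_top hφ]
  exact Submodule.topologicalClosure_minimal _
    (Submodule.span_le.2 (Set.range_subset_iff.2 expDotHom_mem)) hV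

end UniversalApproximation

section IidHitting

variable {α : Type*} [MeasurableSpace α]

lemma measure_pi_forall_notMem (ρ : Measure α) [SigmaFinite ρ] (S : Set α) (L : ℕ) :
    Measure.pi (fun _ : Fin L => ρ) {v | ∀ r, v r ∉ S} = ρ Sᶜ ^ L := by
  simpa [Set.pi] using Measure.pi_pi (fun _ : Fin L => ρ) fun _ => Sᶜ

lemma tendsto_measure_pi_exists_forall_notMem {ρ : Measure α} [IsProbabilityMeasure ρ]
    {𝒮 : Finset (Set α)} (h𝒮 : ∀ S ∈ 𝒮, MeasurableSet S ∧ ρ S ≠ 0) :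
    Tendsto (fun L : ℕ => Measure.pi (fun _ : Fin L => ρ) {v | ∃ S ∈ 𝒮, ∀ r, v r ∉ S})
      atTop (𝓝 0) := by
  have bound (L : ℕ) : Measure.pi (fun _ : Fin L => ρ) {v | ∃ S ∈ 𝒮, ∀ r, v r ∉ S} ≤
      ∑ S ∈ 𝒮, ρ Sᶜ ^ L := by
    simp only [← measure_pi_forall_notMem]
    refine le_of_eq_of_le (congrArg _ ?_) (measure_biUnion_finset_le 𝒮 _)
    ext v
    simp
  refine tendsto_of_tendsto_of_tendsto_of_le_of_le tendsto_const_nhds ?_ (fun _ => zero_le) bound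
  rw [← Finset.sum_const_zero (s := 𝒮)]
  refine tendsto_finsetSum _ fun S hS => ENNReal.tendsto_pow_atTop_nhds_zero_of_lt_one ?_
  rw [prob_compl_eq_one_sub (h𝒮 S hS).1]
  exact ENNReal.sub_lt_self ENNReal.one_ne_top one_ne_zero (h𝒮 S hS).2

end IidHitting

section RandomFeatures

variable {Θ 𝒲 E : Type*} [TopologicalSpace Θ] [TopologicalSpace 𝒲] [NormedAddCommGroup E]
  [NormedSpace ℝ E] {F : Θ → 𝒲 → E} {G : E} {ε : ℝ}

lemma exists_nhds_exists_open_features (hF : Continuous F.uncurry) {θ₀ : Θ}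
    (hG : G ∈ (Submodule.span ℝ (Set.range (F θ₀))).topologicalClosure) (hε : 0 < ε) :
    ∃ U ∈ 𝓝 θ₀, ∃ (k : ℕ) (c : Fin k → ℝ) (S : Fin k → Set 𝒲),
      (∀ j, IsOpen (S j) ∧ (S j).Nonempty) ∧
      ∀ θ ∈ U, ∀ v : Fin k → 𝒲, (∀ j, v j ∈ S j) → ‖G - ∑ j, c j • F θ (v j)‖ < ε := by
  obtain ⟨g, hg, hdist⟩ := Metric.mem_closure_iff.1 hG ε hε
  obtain ⟨k, c, feature, rfl⟩ := Submodule.mem_span_set'.1 hg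
  choose v₀ hv₀ using fun j => (feature j).2
  have near : ∀ᶠ p : Θ × (Fin k → 𝒲) in 𝓝 (θ₀, v₀), ‖G - ∑ j, c j • F p.1 (p.2 j)‖ < ε := by
    refine ContinuousAt.eventually_lt (Continuous.continuousAt ?_) continuousAt_const ?_
    · exact (continuous_const.sub (continuous_finsetSum _ fun j _ => (hF.comp
        (continuous_fst.prodMk ((continuous_apply j).comp continuous_snd))).const_smul _)).norm
    · simpa only [hv₀, dist_eq_norm] using hdist
  rw [nhds_prod_eq, eventually_prod_iff] at near
  obtain ⟨pU, hU, pV, hV, hUV⟩ := near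
  obtain ⟨V, hVsub, hVopen, hvV⟩ := eventually_nhds_iff.1 hV
  obtain ⟨S, hS, hSV⟩ := isOpen_pi_iff'.1 hVopen v₀ hvV
  exact ⟨_, hU, k, c, S, fun j => ⟨(hS j).1, v₀ j, (hS j).2⟩, fun θ hθ v hv =>
    hUV hθ (hVsub v (hSV fun j _ => hv j))⟩

/-- Compactness of the parameter set lets finitely many sets of features serve all parameters. -/
theorem exists_finset_open_forall_meeting_approx (hF : Continuous F.uncurry) {C : Set Θ}
    (hC : IsCompact C) (hG : ∀ θ ∈ C, G ∈ (Submodule.span ℝ (Set.range (F θ))).topologicalClosure)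
    (hε : 0 < ε) :
    ∃ 𝒮 : Finset (Set 𝒲), (∀ S ∈ 𝒮, IsOpen S ∧ S.Nonempty) ∧
      ∀ θ ∈ C, ∀ A : Set 𝒲, (∀ S ∈ 𝒮, (S ∩ A).Nonempty) →
        ∃ e ∈ Submodule.span ℝ (F θ '' A), ‖G - e‖ < ε := by
  classical
  refine hC.induction_on (p := fun s => ∃ 𝒮 : Finset (Set 𝒲), (∀ S ∈ 𝒮, IsOpen S ∧ S.Nonempty) ∧
    ∀ θ ∈ s, ∀ A : Set 𝒲, (∀ S ∈ 𝒮, (S ∩ A).Nonempty) →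
      ∃ e ∈ Submodule.span ℝ (F θ '' A), ‖G - e‖ < ε) ⟨∅, by simp⟩ ?_ ?_ fun θ₀ hθ₀ => ?_
  · rintro s t hst ⟨𝒮, hopen, happrox⟩
    exact ⟨𝒮, hopen, fun θ hθ => happrox θ (hst hθ)⟩
  · rintro s t ⟨𝒮, hopen, happrox⟩ ⟨𝒮', hopen', happrox'⟩
    refine ⟨𝒮 ∪ 𝒮', fun S hS => (Finset.mem_union.1 hS).elim (hopen S) (hopen' S), ?_⟩
    rintro θ (hθ | hθ) A hA
    · exact happrox θ hθ A fun S hS => hA S (Finset.mem_union_left _ hS)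
    · exact happrox' θ hθ A fun S hS => hA S (Finset.mem_union_right _ hS)
  · obtain ⟨U, hU, k, c, S, hS, happrox⟩ := exists_nhds_exists_open_features hF (hG θ₀ hθ₀) hε
    refine ⟨U, mem_nhdsWithin_of_mem_nhds hU, Finset.univ.image S, by simpa using hS, ?_⟩
    intro θ hθ A hA
    choose v hvS hvA using fun j => hA (S j) (Finset.mem_image_of_mem _ (Finset.mem_univ j))
    exact ⟨_, Submodule.sum_mem _ fun j _ => Submodule.smul_mem _ _
      (Submodule.subset_span (Set.mem_image_of_mem _ (hvA j))), happrox θ hθ v hvS⟩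

/-- The exceptional event is uniform in the parameter `θ`, so no joint law of parameter and features
enters. -/
theorem tendsto_measure_pi_exists_forall_le_norm_sub [MeasurableSpace 𝒲]
    [OpensMeasurableSpace 𝒲] {ρ : Measure 𝒲} [IsProbabilityMeasure ρ] [ρ.IsOpenPosMeasure]
    (hF : Continuous F.uncurry) {C : Set Θ} (hC : IsCompact C)
    (hG : ∀ θ ∈ C, G ∈ (Submodule.span ℝ (Set.range (F θ))).topologicalClosure) (hε : 0 < ε) :
    Tendsto (fun L : ℕ => Measure.pi (fun _ : Fin L => ρ)
      {v | ∃ θ ∈ C, ∀ w : Fin L → ℝ, ε ≤ ‖G - ∑ r, w r • F θ (v r)‖}) atTop (𝓝 0) := by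
  obtain ⟨𝒮, hopen, happrox⟩ := exists_finset_open_forall_meeting_approx hF hC hG hε
  refine tendsto_of_tendsto_of_tendsto_of_le_of_le tendsto_const_nhds
    (tendsto_measure_pi_exists_forall_notMem (ρ := ρ) fun S hS =>
      ⟨(hopen S hS).1.measurableSet, (hopen S hS).1.measure_ne_zero ρ (hopen S hS).2⟩)
    (fun _ => zero_le) fun L => measure_mono ?_
  rintro v ⟨θ, hθ, hfar⟩
  by_contra hit
  have meets : ∀ S ∈ 𝒮, (S ∩ Set.range v).Nonempty := by
    intro S hS
    by_contra hdisjoint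
    exact hit ⟨S, hS, fun r hr => hdisjoint ⟨v r, hr, r, rfl⟩⟩
  obtain ⟨e, he, hclose⟩ := happrox θ hθ _ meets
  rw [← Set.range_comp] at he
  obtain ⟨w, rfl⟩ := Submodule.mem_span_range_iff_exists_fun ℝ |>.1 he
  exact (hfar w).not_gt hclose

end RandomFeatures

section LagDynamics

variable {n : ℕ} {κ : Type*}

/-- `B` is upper triangular once its rows are shifted up by one block: the row `(k + 1, i)` vanishes
to the left of the column `(k, i)`. The rows `(0, i)` are unrestricted. -/
def IsShiftedUpperTriangular [LT κ] (B : Matrix (Fin (n + 1) × κ) (Fin (n + 1) × κ) ℝ) : Prop :=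
  ∀ (k : Fin n) i q, toLex q < toLex (k.castSucc, i) → B (k.succ, i) q = 0

/-- The parameters `(B, β)` for which `B` has the shape of the scheme's `A₁⁽²⁾` and whose entries
lie in `S`, except that the entries of `B` off its shifted diagonal may also vanish. -/
def lagParams (n : ℕ) (κ : Type*) [LT κ] (S : Set ℝ) :
    Set (Matrix (Fin (n + 1) × κ) (Fin (n + 1) × κ) ℝ × (κ → ℝ)) :=
  {θ | (∀ p q, θ.1 p q ∈ insert 0 S) ∧ IsShiftedUpperTriangular θ.1 ∧
    (∀ (k : Fin n) i, θ.1 (k.succ, i) (k.castSucc, i) ∈ S) ∧ ∀ i, θ.2 i ∈ S}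

lemma isCompact_lagParams [LT κ] {S : Set ℝ} (hS : IsCompact S) : IsCompact (lagParams n κ S) := by
  have box : IsCompact ((Set.univ.pi fun _ => Set.univ.pi fun _ => insert 0 S :
      Set (Matrix (Fin (n + 1) × κ) (Fin (n + 1) × κ) ℝ)) ×ˢ Set.univ.pi fun _ : κ => S) :=
    (isCompact_univ_pi fun _ => isCompact_univ_pi fun _ => hS.insert 0).prod
      (isCompact_univ_pi fun _ => hS)
  refine box.of_isClosed_subset ?_ fun θ hθ =>
    ⟨fun p _ q _ => hθ.1 p q, fun i _ => hθ.2.2.2 i⟩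
  have entry (p q : Fin (n + 1) × κ) : Continuous fun θ :
      Matrix (Fin (n + 1) × κ) (Fin (n + 1) × κ) ℝ × (κ → ℝ) => θ.1 p q :=
    continuous_fst.matrix_elem p q
  simp only [lagParams, IsShiftedUpperTriangular, Set.ofPred_and, Set.ofPred_forall]
  refine .inter ?_ (.inter ?_ (.inter ?_ ?_))
  · exact isClosed_iInter fun p => isClosed_iInter fun q =>
      (hS.insert 0).isClosed.preimage (entry p q)
  · exact isClosed_iInter fun k => isClosed_iInter fun i => isClosed_iInter fun q =>
      isClosed_iInter fun _ => isClosed_eq (entry _ q) continuous_const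
  · exact isClosed_iInter fun k => isClosed_iInter fun i => hS.isClosed.preimage (entry _ _)
  · exact isClosed_iInter fun i => hS.isClosed.preimage ((continuous_apply i).comp continuous_snd)

variable [Fintype κ]

/-- The evolution at the times `0, …, n` of a block of the state that starts at `0`, whose linear
part is `B`, and whose first row of coordinates alone receives the data `y`, weighted by `σ ∘ β`. In
the sampling scheme this is the last block, with `κ = Fin d`. -/
def lag (σ : ℝ → ℝ) (B : Matrix (Fin (n + 1) × κ) (Fin (n + 1) × κ) ℝ) (β : κ → ℝ)
    (y : Fin n → κ → ℝ) : Fin (n + 1) → Fin (n + 1) × κ → ℝ :=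
  Fin.induction (motive := fun _ => Fin (n + 1) × κ → ℝ) 0 fun t Y p =>
    Y p + σ ((B *ᵥ Y) p) + if p.1 = 0 then σ (β p.2) * y t p.2 else 0

/-- The value at the final time `n` of the evolution `lag`, with its parameters paired into one
point `θ = (B, β)`. -/
def lagState (σ : ℝ → ℝ) (θ : Matrix (Fin (n + 1) × κ) (Fin (n + 1) × κ) ℝ × (κ → ℝ))
    (y : Fin n → κ → ℝ) : Fin (n + 1) × κ → ℝ :=
  lag σ θ.1 θ.2 y (Fin.last n)

variable {σ : ℝ → ℝ} {B : Matrix (Fin (n + 1) × κ) (Fin (n + 1) × κ) ℝ} {β : κ → ℝ}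
  {y y' : Fin n → κ → ℝ}

lemma lag_succ (σ : ℝ → ℝ) (B : Matrix (Fin (n + 1) × κ) (Fin (n + 1) × κ) ℝ) (β : κ → ℝ)
    (y : Fin n → κ → ℝ) (t : Fin n) (p : Fin (n + 1) × κ) :
    lag σ B β y t.succ p = lag σ B β y t.castSucc p + σ ((B *ᵥ lag σ B β y t.castSucc) p) +
      if p.1 = 0 then σ (β p.2) * y t p.2 else 0 := rfl

lemma continuous_lag (hσ : Continuous σ) (t : Fin (n + 1)) :
    Continuous fun q : (Matrix (Fin (n + 1) × κ) (Fin (n + 1) × κ) ℝ × (κ → ℝ)) ×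
      (Fin n → κ → ℝ) => lag σ q.1.1 q.1.2 q.2 t := by
  induction t using Fin.induction with
  | zero => exact continuous_const
  | succ t ih =>
    refine continuous_pi fun p => ?_
    have ih_apply := continuous_pi_iff.1 ih
    simp only [lag_succ]
    refine ((ih_apply p).add (hσ.comp ?_)).add ?_
    · exact continuous_pi_iff.1 (continuous_fst.fst.matrix_mulVec ih) p
    · split_ifs <;> fun_prop

lemma continuous_lagState (hσ : Continuous σ) :
    Continuous (lagState σ : _ → (Fin n → κ → ℝ) → _).uncurry :=
  continuous_lag hσ (Fin.last n)

variable [LinearOrder κ]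

lemma lag_eq_zero (h0 : σ 0 = 0) (hB : IsShiftedUpperTriangular B) (β : κ → ℝ)
    (y : Fin n → κ → ℝ) (t : Fin (n + 1)) :
    ∀ p : Fin (n + 1) × κ, (t : ℕ) ≤ p.1 → lag σ B β y t p = 0 := by
  induction t using Fin.induction with
  | zero => exact fun p _ => rfl
  | succ t ih =>
    rintro ⟨k, i⟩ hk
    cases k using Fin.cases with
    | zero => simp at hk
    | succ k =>
      simp only [Fin.val_succ, Nat.add_le_add_iff_right] at hk
      have mulVec_eq_zero : (B *ᵥ lag σ B β y t.castSucc) (k.succ, i) = 0 := by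
        refine Finset.sum_eq_zero fun q _ => ?_
        by_cases hq : toLex q < toLex (k.castSucc, i)
        · exact mul_eq_zero_of_left (hB k i q hq) _
        · refine mul_eq_zero_of_right _ (ih q (hk.trans ?_))
          rw [Prod.Lex.toLex_lt_toLex, not_or] at hq
          exact Fin.le_def.1 (not_lt.1 hq.1)
      rw [lag_succ, mulVec_eq_zero, h0, ih (k.succ, i) (by simp; omega)]
      simp

/-- Back substitution: a row involves only its diagonal coordinate, with a nonzero coefficient, and
larger coordinates, which agree by descending lexicographic induction. -/
lemma lag_step_injective (hσ : Function.Injective σ) (h0 : σ 0 = 0)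
    (hB : IsShiftedUpperTriangular B) (hdiag : ∀ (k : Fin n) i, B (k.succ, i) (k.castSucc, i) ≠ 0)
    {t : Fin n} (h : lag σ B β y t.succ = lag σ B β y' t.succ) :
    lag σ B β y t.castSucc = lag σ B β y' t.castSucc := by
  set Y := lag σ B β y t.castSucc with hY
  set Y' := lag σ B β y' t.castSucc with hY'
  suffices agree : ∀ p : Fin (n + 1) ×ₗ κ, Y (ofLex p) = Y' (ofLex p) from
    funext fun p => agree (toLex p)
  intro p
  induction p using (wellFounded_gt (α := Fin (n + 1) ×ₗ κ)).induction with
  | h p ih =>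
  obtain ⟨⟨k, i⟩, rfl⟩ := toLex.surjective p
  simp only [ofLex_toLex]
  by_cases hk : (t : ℕ) ≤ k
  · rw [hY, hY', lag_eq_zero h0 hB β y _ (k, i) (by simpa using hk),
      lag_eq_zero h0 hB β y' _ (k, i) (by simpa using hk)]
  obtain ⟨k, rfl⟩ : ∃ k' : Fin n, k = k'.castSucc := ⟨⟨k, by omega⟩, rfl⟩
  have agree_succ : Y (k.succ, i) = Y' (k.succ, i) :=
    ih (toLex (k.succ, i)) (Prod.Lex.toLex_lt_toLex.2 (Or.inl Fin.castSucc_lt_succ))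
  have step := congrFun h (k.succ, i)
  rw [lag_succ, lag_succ, ← hY, ← hY', agree_succ] at step
  have mulVec_agree : (B *ᵥ Y) (k.succ, i) = (B *ᵥ Y') (k.succ, i) := hσ (by simpa using step)
  have sum_eq_zero : ∑ q, B (k.succ, i) q * (Y q - Y' q) = 0 := by
    simp only [mul_sub, Finset.sum_sub_distrib]
    exact sub_eq_zero.2 mulVec_agree
  rw [Finset.sum_eq_single (k.castSucc, i)] at sum_eq_zero
  · exact sub_eq_zero.1 ((mul_eq_zero.1 sum_eq_zero).resolve_left (hdiag k i))
  · intro q _ hq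
    rcases lt_or_gt_of_ne (toLex.injective.ne hq) with hlt | hgt
    · exact mul_eq_zero_of_left (hB k i q hlt) _
    · exact mul_eq_zero_of_right _ (sub_eq_zero.2 (ih (toLex q) hgt))
  · simp

lemma lagState_injective (hσ : Function.Injective σ) (h0 : σ 0 = 0)
    (hB : IsShiftedUpperTriangular B) (hdiag : ∀ (k : Fin n) i, B (k.succ, i) (k.castSucc, i) ≠ 0)
    (hβ : ∀ i, β i ≠ 0) : Function.Injective (lagState σ (B, β)) := by
  intro y y' h
  have agree : ∀ t, lag σ B β y t = lag σ B β y' t := by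
    intro t
    induction t using Fin.reverseInduction with
    | last => exact h
    | cast t ih => exact lag_step_injective hσ h0 hB hdiag ih
  funext t i
  have step := congrFun (agree t.succ) (0, i)
  rw [lag_succ, lag_succ, agree t.castSucc] at step
  have weight_ne_zero : σ (β i) ≠ 0 := fun hzero => hβ i (hσ (hzero.trans h0.symm))
  simpa [weight_ne_zero] using step

lemma lagState_injective_of_mem_lagParams {S : Set ℝ} (hσ : Function.Injective σ) (h0 : σ 0 = 0)
    (hS : 0 ∉ S) {θ : Matrix (Fin (n + 1) × κ) (Fin (n + 1) × κ) ℝ × (κ → ℝ)}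
    (hθ : θ ∈ lagParams n κ S) : Function.Injective (lagState σ θ) :=
  lagState_injective hσ h0 hθ.2.1 (fun k i => ne_of_mem_of_not_mem (hθ.2.2.1 k i) hS)
    fun i => ne_of_mem_of_not_mem (hθ.2.2.2 i) hS

end LagDynamics

section Scheme

variable {n d M : ℕ} {m : Fin d → ℕ} {σ : ℝ → ℝ}

lemma schemeA₁₂_last (z : HiddenIdx n d M m → ℝ) (p : Fin (n + 1) × Fin d) (j : Fin d) :
    schemeA₁₂ z p (Fin.last n, j) = 0 := by
  obtain ⟨k, i⟩ := p
  cases k using Fin.cases <;> simp [schemeA₁₂]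

lemma schemeA₁₂_succ_castSucc (z : HiddenIdx n d M m → ℝ) (k l : Fin n) (i j : Fin d) :
    schemeA₁₂ z (k.succ, i) (l.castSucc, j) = schemeU z (k, i) (l, j) := by
  simp [schemeA₁₂]

lemma isShiftedUpperTriangular_schemeA₁₂ (z : HiddenIdx n d M m → ℝ) :
    IsShiftedUpperTriangular (schemeA₁₂ z) := by
  rintro k i ⟨l, j⟩ h
  cases l using Fin.lastCases with
  | last => exact schemeA₁₂_last z _ j
  | cast l =>
    rw [schemeA₁₂_succ_castSucc, schemeU, Matrix.of_apply, dif_neg]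
    rw [not_le, Prod.Lex.toLex_lt_toLex]
    simpa [Prod.Lex.toLex_lt_toLex] using h

/-- The parameters with which the last block of the scheme's state evolves as `lag` does. -/
def lagParam (z : HiddenIdx n d M m → ℝ) :
    Matrix (Fin (n + 1) × Fin d) (Fin (n + 1) × Fin d) ℝ × (Fin d → ℝ) :=
  (schemeA₁₂ z, fun i => z (.α i))

lemma lagParam_mem_lagParams {z : HiddenIdx n d M m → ℝ} {S : Set ℝ}
    (hU : ∀ p q h, z (.U p q h) ∈ S) (hα : ∀ i, z (.α i) ∈ S) :
    lagParam z ∈ lagParams n (Fin d) S := by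
  refine ⟨?_, isShiftedUpperTriangular_schemeA₁₂ z, fun k i => ?_, hα⟩
  · rintro ⟨k, i⟩ ⟨l, j⟩
    cases k using Fin.cases with
    | zero => exact .inl rfl
    | succ k =>
      cases l using Fin.lastCases with
      | last => exact .inl (schemeA₁₂_last z _ j)
      | cast l =>
        change schemeA₁₂ z (k.succ, i) (l.castSucc, j) ∈ _
        rw [schemeA₁₂_succ_castSucc, schemeU, Matrix.of_apply]
        split_ifs with h
        · exact .inr (hU _ _ h)
        · exact .inl rfl
  · change schemeA₁₂ z (k.succ, i) (k.castSucc, i) ∈ S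
    rw [schemeA₁₂_succ_castSucc, schemeU, Matrix.of_apply, dif_pos le_rfl]
    exact hU _ _ _

lemma randSig_succ {ι : Type*} [Fintype ι] {T d : ℕ} (σ : ℝ → ℝ)
    (A₁ : Matrix ι ι ℝ) (ξ₁ : ι → ℝ) (A₂ : Fin d → Matrix ι ι ℝ) (ξ₂ : Fin d → ι → ℝ)
    (x : Fin T → Fin d → ℝ) (t : Fin T) (j : ι) :
    randSig σ A₁ ξ₁ A₂ ξ₂ x t.succ j = randSig σ A₁ ξ₁ A₂ ξ₂ x t.castSucc j +
      σ ((A₁ *ᵥ randSig σ A₁ ξ₁ A₂ ξ₂ x t.castSucc + ξ₁) j) +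
      ∑ i, σ ((A₂ i *ᵥ randSig σ A₁ ξ₁ A₂ ξ₂ x t.castSucc + ξ₂ i) j) * x t i := rfl

lemma deltaRS_apply {ι : Type*} [Fintype ι] {n d : ℕ} (σ : ℝ → ℝ)
    (A₁ : Matrix ι ι ℝ) (ξ₁ : ι → ℝ) (A₂ : Fin d → Matrix ι ι ℝ) (ξ₂ : Fin d → ι → ℝ)
    (x : Fin (n + 1) → Fin d → ℝ) (j : ι) :
    deltaRS σ A₁ ξ₁ A₂ ξ₂ x j =
      σ ((A₁ *ᵥ randSig σ A₁ ξ₁ A₂ ξ₂ x (Fin.last n).castSucc + ξ₁) j) +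
      ∑ i, σ ((A₂ i *ᵥ randSig σ A₁ ξ₁ A₂ ξ₂ x (Fin.last n).castSucc + ξ₂ i) j) *
        x (Fin.last n) i := by
  rw [deltaRS, Pi.sub_apply, ← Fin.succ_last, randSig_succ, add_assoc, add_sub_cancel_left]

lemma schemeA₁_mulVec_lag (z : HiddenIdx n d M m → ℝ) (S : StateIdx (n + 1) d M m → ℝ)
    (p : Fin (n + 1) × Fin d) :
    (schemeA₁ z *ᵥ S) (.inr (.inr p)) = (schemeA₁₂ z *ᵥ fun q => S (.inr (.inr q))) p := by
  simp [Matrix.mulVec, dotProduct, Fintype.sum_sum_type, schemeA₁]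

lemma schemeA₁_mulVec_inl (z : HiddenIdx n d M m → ℝ) (S : StateIdx (n + 1) d M m → ℝ)
    (r : Fin M) :
    (schemeA₁ z *ᵥ S) (.inl r) = ∑ c, z (.A₁₁ r c) * S (.inr (.inr c)) := by
  simp [Matrix.mulVec, dotProduct, Fintype.sum_sum_type, schemeA₁]

lemma schemeA₁_mulVec_inr_inl (z : HiddenIdx n d M m → ℝ) (S : StateIdx (n + 1) d M m → ℝ)
    (s : Σ i : Fin d, Fin (m i)) : (schemeA₁ z *ᵥ S) (.inr (.inl s)) = 0 := by
  simp [Matrix.mulVec, dotProduct, schemeA₁]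

lemma schemeA₂_mulVec_inl (z : HiddenIdx n d M m → ℝ) (i : Fin d)
    (S : StateIdx (n + 1) d M m → ℝ) (r : Fin M) : (schemeA₂ z i *ᵥ S) (.inl r) = 0 := by
  simp [Matrix.mulVec, dotProduct, schemeA₂]

lemma schemeA₂_mulVec_lag (z : HiddenIdx n d M m → ℝ) (i : Fin d)
    (S : StateIdx (n + 1) d M m → ℝ) (p : Fin (n + 1) × Fin d) :
    (schemeA₂ z i *ᵥ S) (.inr (.inr p)) = 0 := by
  simp [Matrix.mulVec, dotProduct, schemeA₂]

lemma schemeA₂_mulVec_inr_inl (z : HiddenIdx n d M m → ℝ) (i : Fin d)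
    (S : StateIdx (n + 1) d M m → ℝ) (s : Σ i : Fin d, Fin (m i)) :
    (schemeA₂ z i *ᵥ S) (.inr (.inl s)) =
      if s.1 = i then ∑ c, z (.A₂ s.1 s.2 c) * S (.inr (.inr c)) else 0 := by
  simp only [Matrix.mulVec, dotProduct, Fintype.sum_sum_type, schemeA₂]
  split_ifs with h <;> simp [h]

lemma randSig_lag (h0 : σ 0 = 0) (z : HiddenIdx n d M m → ℝ) (x : Fin (n + 1) → Fin d → ℝ)
    (t : Fin (n + 1)) (p : Fin (n + 1) × Fin d) :
    randSig σ (schemeA₁ z) (schemeξ₁ z) (schemeA₂ z) (schemeξ₂ z) x t.castSucc (.inr (.inr p)) =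
      lag σ (schemeA₁₂ z) (fun i => z (.α i)) (Fin.init x) t p := by
  induction t using Fin.induction generalizing p with
  | zero => rfl
  | succ t ih =>
    rw [← Fin.succ_castSucc, randSig_succ, lag_succ, ih p]
    simp only [Pi.add_apply, schemeA₁_mulVec_lag, schemeA₂_mulVec_lag, zero_add, ih]
    congr 1
    · simp [schemeξ₁]
    · obtain ⟨k, i⟩ := p
      by_cases hk : k = 0
      · subst hk
        rw [Finset.sum_eq_single i]
        · simp [schemeξ₂, Fin.init]
        · intro j _ hj
          simp [schemeξ₂, hj.symm, h0]
        · simp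
      · simp [schemeξ₂, hk, h0]

/-- The names of the weights and the bias of a neuron of the block `0`. -/
def neuronIdx₁ (r : Fin M) (o : Option (Fin (n + 1) × Fin d)) : HiddenIdx n d M m :=
  o.elim (.ξ₁ r) (.A₁₁ r)

/-- The names of the weights and the bias of a neuron of the block `i`. -/
def neuronIdx₂ (i : Fin d) (r : Fin (m i)) (o : Option (Fin (n + 1) × Fin d)) :
    HiddenIdx n d M m :=
  o.elim (.ξ₂ i r) (.A₂ i r)

lemma neuronIdx₁_injective :
    Function.Injective (neuronIdx₁ : Fin M → _ → HiddenIdx n d M m).uncurry := by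
  rintro ⟨r, _ | c⟩ ⟨s, _ | c'⟩ h <;> simp_all [neuronIdx₁]

lemma neuronIdx₂_injective (i : Fin d) :
    Function.Injective (neuronIdx₂ i : _ → _ → HiddenIdx n d M m).uncurry := by
  rintro ⟨r, _ | c⟩ ⟨s, _ | c'⟩ h <;> simp_all [neuronIdx₂]

lemma schemeDeltaRS_inl {σ : C(ℝ, ℝ)} (h0 : σ 0 = 0) (z : HiddenIdx n d M m → ℝ)
    (x : Fin (n + 1) → Fin d → ℝ) (r : Fin M) :
    schemeDeltaRS σ z x (.inl r) = neuron σ (fun o => z (neuronIdx₁ r o))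
      (lagState σ (lagParam z) (Fin.init x)) := by
  rw [schemeDeltaRS, deltaRS_apply]
  simp only [Pi.add_apply, schemeA₁_mulVec_inl, schemeA₂_mulVec_inl, randSig_lag h0, schemeξ₁,
    schemeξ₂, add_zero, h0, zero_mul, Finset.sum_const_zero]
  rfl

lemma schemeDeltaRS_inr_inl {σ : C(ℝ, ℝ)} (h0 : σ 0 = 0) (z : HiddenIdx n d M m → ℝ)
    (x : Fin (n + 1) → Fin d → ℝ) (i : Fin d) (r : Fin (m i)) :
    schemeDeltaRS σ z x (.inr (.inl ⟨i, r⟩)) = neuron σ (fun o => z (neuronIdx₂ i r o))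
      (lagState σ (lagParam z) (Fin.init x)) * x (Fin.last n) i := by
  rw [schemeDeltaRS, deltaRS_apply]
  simp only [Pi.add_apply, schemeA₁_mulVec_inr_inl, schemeA₂_mulVec_inr_inl, randSig_lag h0,
    schemeξ₁, schemeξ₂, add_zero, h0, zero_add]
  rw [Finset.sum_eq_single_of_mem i (Finset.mem_univ i) fun j _ hj => by simp [hj.symm, h0],
    if_pos rfl, if_pos rfl]
  rfl

theorem outputVec_dotProduct_schemeDeltaRS {σ : C(ℝ, ℝ)} (h0 : σ 0 = 0)
    (z : HiddenIdx n d M m → ℝ) (x : Fin (n + 1) → Fin d → ℝ) (w₀ : Fin M → ℝ)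
    (w : (i : Fin d) → Fin (m i) → ℝ) :
    outputVec (n + 1) w₀ w ⬝ᵥ schemeDeltaRS σ z x =
      ∑ r, w₀ r * neuron σ (fun o => z (neuronIdx₁ r o))
        (lagState σ (lagParam z) (Fin.init x)) +
      ∑ i, (∑ r, w i r * neuron σ (fun o => z (neuronIdx₂ i r o))
        (lagState σ (lagParam z) (Fin.init x))) * x (Fin.last n) i := by
  simp only [dotProduct, Fintype.sum_sum_type, Fintype.sum_sigma, outputVec, zero_mul,
    Finset.sum_const_zero, add_zero, schemeDeltaRS_inl h0, schemeDeltaRS_inr_inl h0,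
    Finset.sum_mul, mul_assoc]

end Scheme

section Sampling

lemma exists_isCompact_notMem_measure_compl_lt {α : Type*} [TopologicalSpace α] [T2Space α]
    [MeasurableSpace α] [OpensMeasurableSpace α] {μ : Measure α} [IsFiniteMeasure μ]
    [μ.InnerRegularCompactLTTop] {a : α} (ha : μ {a} = 0) {δ : ENNReal} (hδ : δ ≠ 0) :
    ∃ S, IsCompact S ∧ a ∉ S ∧ μ Sᶜ < δ := by
  obtain ⟨S, hSa, hS, hlt⟩ := (measurableSet_singleton a).compl.exists_isCompact_sdiff_lt
    (measure_ne_top μ _) hδ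
  refine ⟨S, hS, fun h => hSa h rfl, lt_of_le_of_lt ?_ hlt⟩
  calc μ Sᶜ ≤ μ ({a} ∪ {a}ᶜ \ S) := measure_mono fun x hx => by
        by_cases hxa : x = a
        · exact .inl hxa
        · exact .inr ⟨hxa, hx⟩
    _ ≤ μ {a} + μ ({a}ᶜ \ S) := measure_union_le _ _
    _ = μ ({a}ᶜ \ S) := by rw [ha, zero_add]

lemma map_eq_pi_pi_of_iIndepFun {Ω α ι κ : Type*} [MeasurableSpace Ω] [MeasurableSpace α]
    [Fintype ι] [Fintype κ] {P : Measure Ω} {μ : Measure α} [IsProbabilityMeasure μ]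
    {X : ι → κ → Ω → α} (hX : ∀ r o, Measurable (X r o)) (law : ∀ r o, P.map (X r o) = μ)
    (indep : iIndepFun (fun e : ι × κ => X e.1 e.2) P) :
    P.map (fun ω r o => X r o ω) = Measure.pi fun _ => Measure.pi fun _ => μ := by
  have := indep.isProbabilityMeasure
  have joint : P.map (fun ω (e : ι × κ) => X e.1 e.2 ω) = Measure.infinitePi fun _ => μ := by
    simpa only [law] using indep.map_fun_eq_infinitePi_map fun e : ι × κ => hX e.1 e.2
  simp only [← Measure.infinitePi_eq_pi]
  rw [← Measure.infinitePi_map_curry, ← joint, Measure.map_map (by fun_prop) (by fun_prop)]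
  rfl

lemma exists_measurableSet_lt_measureReal_disjoint {Ω : Type*} [MeasurableSpace Ω]
    {P : Measure Ω} [IsProbabilityMeasure P] {B : Set Ω} {α : ℝ}
    (hB : P B < ENNReal.ofReal (1 - α)) :
    ∃ E, MeasurableSet E ∧ α < P.real E ∧ Disjoint E B := by
  have hmeas := measurableSet_toMeasurable P B
  refine ⟨(toMeasurable P B)ᶜ, hmeas.compl, ?_,
    Set.disjoint_left.2 fun ω hω hB => hω (subset_toMeasurable P B hB)⟩
  rw [probReal_compl_eq_one_sub hmeas, measureReal_def, measure_toMeasurable]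
  linarith [ENNReal.toReal_lt_of_lt_ofReal hB]

variable {n d M : ℕ} {m : Fin d → ℕ}

section Law

variable {Ω : Type*} [MeasurableSpace Ω] {P : Measure Ω} {μ : Measure ℝ}
  {ζ : HiddenIdx n d M m → Ω → ℝ}

lemma IsSamplingScheme₂.measure_notMem (hζ : IsSamplingScheme₂ P μ ζ) {S : Set ℝ}
    (hS : MeasurableSet S) (e : HiddenIdx n d M m) : P {ω | ζ e ω ∉ S} = μ Sᶜ := by
  rw [← hζ.law e, Measure.map_apply (hζ.measurable e) hS.compl]
  rfl

lemma IsSamplingScheme₂.measure_lagParam_notMem_le (hζ : IsSamplingScheme₂ P μ ζ) {S : Set ℝ}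
    (hS : MeasurableSet S) :
    P {ω | lagParam (fun e => ζ e ω) ∉ lagParams n (Fin d) S} ≤ ((n * d) ^ 2 + d) * μ Sᶜ := by
  have cover : {ω | lagParam (fun e => ζ e ω) ∉ lagParams n (Fin d) S} ⊆
      (⋃ (p) (q), {ω | ∃ h, ζ (.U p q h) ω ∉ S}) ∪ ⋃ i, {ω | ζ (.α i) ω ∉ S} := by
    intro ω hω
    by_contra! hgood
    simp only [Set.mem_union, Set.mem_iUnion, Set.mem_ofPred_eq, not_or, not_exists, not_not]
      at hgood
    exact hω (lagParam_mem_lagParams hgood.1 hgood.2)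
  have entry (p q : Fin n × Fin d) : P {ω | ∃ h, ζ (.U p q h) ω ∉ S} ≤ μ Sᶜ := by
    by_cases h : toLex p ≤ toLex q
    · simp only [h, exists_true_left, hζ.measure_notMem hS, le_refl]
    · simp [h]
  calc P {ω | lagParam (fun e => ζ e ω) ∉ lagParams n (Fin d) S}
      ≤ ∑ p, ∑ q, P {ω | ∃ h, ζ (.U p q h) ω ∉ S} + ∑ i, P {ω | ζ (.α i) ω ∉ S} :=
        (measure_mono cover).trans <| (measure_union_le _ _).trans <| add_le_add
          ((measure_iUnion_fintype_le _ _).trans <|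
            Finset.sum_le_sum fun p _ => measure_iUnion_fintype_le _ _)
          (measure_iUnion_fintype_le _ _)
    _ ≤ ∑ _p : Fin n × Fin d, ∑ _q : Fin n × Fin d, μ Sᶜ + ∑ _i : Fin d, μ Sᶜ := by
        gcongr with p _ q _ i _
        · exact entry p q
        · exact (hζ.measure_notMem hS _).le
    _ = ((n * d) ^ 2 + d) * μ Sᶜ := by
        simp only [Finset.sum_const, Finset.card_univ, Fintype.card_prod, Fintype.card_fin,
          nsmul_eq_mul, Nat.cast_mul]
        ring

lemma IsSamplingScheme₂.measure_mem_le_pi_pi (hζ : IsSamplingScheme₂ P μ ζ)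
    [IsProbabilityMeasure μ] {ι κ : Type*} [Fintype ι] [Fintype κ]
    {idx : ι → κ → HiddenIdx n d M m} (hidx : Function.Injective idx.uncurry)
    (s : Set (ι → κ → ℝ)) :
    P {ω | (fun r o => ζ (idx r o) ω) ∈ s} ≤
      Measure.pi (fun _ => Measure.pi fun _ => μ) s := by
  rw [← map_eq_pi_pi_of_iIndepFun (fun r o => hζ.measurable (idx r o)) (fun r o => hζ.law _)
    (hζ.indep.precomp hidx)]
  exact Measure.le_map_apply (measurable_pi_lambda _ fun r => measurable_pi_lambda _ fun o =>
    hζ.measurable _).aemeasurable s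

end Law

/-- Some linear combination of the neurons with the weights `v r`, reading the state `lagState σ θ`,
is within `η` of `G` on `Q`. -/
def NeuronsApprox {κ ι : Type*} [Fintype κ] [Fintype ι] (σ : C(ℝ, ℝ))
    (Q : Set (Fin n → κ → ℝ)) (η : ℝ) (G : (Fin n → κ → ℝ) → ℝ)
    (θ : Matrix (Fin (n + 1) × κ) (Fin (n + 1) × κ) ℝ × (κ → ℝ))
    (v : ι → Option (Fin (n + 1) × κ) → ℝ) : Prop :=
  ∃ w : ι → ℝ, ∀ y ∈ Q, ‖G y - ∑ r, w r * neuron σ (v r) (lagState σ θ y)‖ < η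

variable {σ : C(ℝ, ℝ)} {C η : ℝ}

theorem tendsto_measure_pi_exists_not_neuronsApprox {κ : Type*} [Fintype κ] [LinearOrder κ]
    (hC : ∀ t, |σ t| ≤ C) (hinj : Function.Injective σ) (h0 : σ 0 = 0) (μ : Measure ℝ)
    [IsProbabilityMeasure μ] [μ.IsOpenPosMeasure] {S : Set ℝ} (hS : IsCompact S) (hS0 : 0 ∉ S)
    {Q : Set (Fin n → κ → ℝ)} (hQ : IsCompact Q) (hη : 0 < η) {G : (Fin n → κ → ℝ) → ℝ}
    (hG : ContinuousOn G Q) :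
    Tendsto (fun L : ℕ => Measure.pi (fun _ : Fin L => Measure.pi fun _ => μ)
      {v | ∃ θ ∈ lagParams n κ S, ¬ NeuronsApprox σ Q η G θ v}) atTop (𝓝 0) := by
  obtain ⟨l₀, l₁, hl, h₀, h₁⟩ :=
    exists_limits_of_continuous_injective_bounded σ.continuous hinj hC
  have : CompactSpace Q := isCompact_iff_compactSpace.1 hQ
  have lagState_continuous := continuous_lagState (n := n) (κ := κ) σ.continuous
  let lagMap (θ : Matrix (Fin (n + 1) × κ) (Fin (n + 1) × κ) ℝ × (κ → ℝ)) :
      C(Q, Fin (n + 1) × κ → ℝ) :=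
    ⟨fun y => lagState σ θ y,
      lagState_continuous.comp (continuous_const.prodMk continuous_subtype_val)⟩
  let feature θ v : C(Q, ℝ) := (neuron σ v).comp (lagMap θ)
  have feature_continuous : Continuous feature.uncurry :=
    ContinuousMap.continuous_of_continuous_uncurry _ <|
      (continuous_neuron σ).comp <| continuous_fst.snd.prodMk <| lagState_continuous.comp <|
        continuous_fst.fst.prodMk (continuous_subtype_val.comp continuous_snd)
  refine tendsto_of_tendsto_of_tendsto_of_le_of_le tendsto_const_nhds
    (tendsto_measure_pi_exists_forall_le_norm_sub (ρ := Measure.pi fun _ => μ)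
      (G := ⟨Q.domRestrict G, hG.domRestrict⟩) feature_continuous (isCompact_lagParams hS)
      (fun θ hθ => ?_) hη) (fun _ => zero_le) fun L => measure_mono ?_
  · rw [topologicalClosure_span_range_neuron_comp_eq_top hC hl h₀ h₁]
    · trivial
    · exact (lagState_injective_of_mem_lagParams hinj h0 hS0 hθ).comp Subtype.val_injective
  · rintro v ⟨θ, hθ, hfar⟩
    refine ⟨θ, hθ, fun w => not_lt.1 fun hclose => hfar ⟨w, fun y hy => ?_⟩⟩
    have pointwise := (ContinuousMap.norm_coe_le_norm _ ⟨y, hy⟩).trans_lt hclose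
    rwa [ContinuousMap.sub_apply, ContinuousMap.sum_apply] at pointwise

theorem exists_widths_measure_not_neuronsApprox_lt (hC : ∀ t, |σ t| ≤ C)
    (hinj : Function.Injective σ) (h0 : σ 0 = 0) (μ : Measure ℝ) [IsProbabilityMeasure μ]
    [μ.IsOpenPosMeasure] (hμ : μ {0} = 0) {Q : Set (Fin n → Fin d → ℝ)} (hQ : IsCompact Q)
    (hη : 0 < η) {g : (Fin n → Fin d → ℝ) → ℝ} (hg : ContinuousOn g Q)
    {h : Fin d → (Fin n → Fin d → ℝ) → ℝ} (hh : ∀ i, ContinuousOn (h i) Q) {δ : ENNReal}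
    (hδ : δ ≠ 0) :
    ∃ (M : ℕ) (m : Fin d → ℕ), 0 < M ∧ (∀ i, 0 < m i) ∧
      ∀ (Ω : Type*) [MeasurableSpace Ω] (P : Measure Ω) (ζ : HiddenIdx n d M m → Ω → ℝ),
        IsSamplingScheme₂ P μ ζ →
        P {ω | ¬ (NeuronsApprox σ Q η g (lagParam fun e => ζ e ω)
            (fun r o => ζ (neuronIdx₁ r o) ω) ∧
          ∀ i, NeuronsApprox σ Q η (h i) (lagParam fun e => ζ e ω)
            fun r o => ζ (neuronIdx₂ i r o) ω)} < δ := by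
  obtain ⟨γ, hγ, hγδ⟩ : ∃ γ : NNReal, 0 < γ ∧ (γ : ENNReal) * ((n * d) ^ 2 + d + (1 + d)) < δ :=
    ENNReal.exists_nnreal_pos_mul_lt (by finiteness) hδ
  have hγpos : (0 : ENNReal) < γ := ENNReal.coe_pos.2 hγ
  obtain ⟨S, hS, hS0, hSγ⟩ := exists_isCompact_notMem_measure_compl_lt hμ hγpos.ne'
  have width (G) (hG : ContinuousOn G Q) :=
    (((tendsto_measure_pi_exists_not_neuronsApprox hC hinj h0 μ hS hS0 hQ hη hG).eventually_le_const
      hγpos).and (eventually_gt_atTop 0)).exists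
  obtain ⟨M, hM, hMpos⟩ := width g hg
  choose m hm hmpos using fun i => width (h i) (hh i)
  refine ⟨M, m, hMpos, hmpos, fun Ω _ P ζ hζ => lt_of_le_of_lt ?_ hγδ⟩
  let bad₀ : Set Ω := {ω | lagParam (fun e => ζ e ω) ∉ lagParams n (Fin d) S}
  let bad₁ : Set Ω := {ω | (fun r o => ζ (neuronIdx₁ r o) ω) ∈
    {v | ∃ θ ∈ lagParams n (Fin d) S, ¬ NeuronsApprox σ Q η g θ v}}
  let bad₂ (i : Fin d) : Set Ω := {ω | (fun r o => ζ (neuronIdx₂ i r o) ω) ∈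
    {v | ∃ θ ∈ lagParams n (Fin d) S, ¬ NeuronsApprox σ Q η (h i) θ v}}
  calc _ ≤ P (bad₀ ∪ (bad₁ ∪ ⋃ i, bad₂ i)) := measure_mono fun ω hω => by
        by_contra! hgood
        simp only [bad₀, bad₁, bad₂, Set.mem_union, Set.mem_iUnion, Set.mem_ofPred_eq, not_or,
          not_exists, not_and, not_not] at hgood
        exact hω ⟨hgood.2.1 _ hgood.1, fun i => hgood.2.2 i _ hgood.1⟩
    _ ≤ P bad₀ + (P bad₁ + ∑ i, P (bad₂ i)) :=
        (measure_union_le _ _).trans <| add_le_add_right ((measure_union_le _ _).trans <|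
          add_le_add_right (measure_iUnion_fintype_le _ _) _) _
    _ ≤ ((n * d) ^ 2 + d) * γ + (γ + ∑ _i : Fin d, (γ : ENNReal)) := by
        gcongr with i
        · exact (hζ.measure_lagParam_notMem_le hS.measurableSet).trans (by gcongr)
        · exact (hζ.measure_mem_le_pi_pi neuronIdx₁_injective _).trans hM
        · exact (hζ.measure_mem_le_pi_pi (neuronIdx₂_injective i) _).trans (hm i)
    _ = γ * ((n * d) ^ 2 + d + (1 + d)) := by
        simp only [Finset.sum_const, Finset.card_univ, Fintype.card_fin, nsmul_eq_mul]
        ring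

lemma exists_norm_sub_outputVec_dotProduct_le (h0 : σ 0 = 0) {K : Set (Fin d → ℝ)} {R : ℝ}
    (hR : ∀ y ∈ K, ‖y‖ ≤ R) {g : (Fin n → Fin d → ℝ) → ℝ}
    {h : Fin d → (Fin n → Fin d → ℝ) → ℝ} {z : HiddenIdx n d M m → ℝ}
    (hg : NeuronsApprox σ (Set.univ.pi fun _ => K) η g (lagParam z) fun r o => z (neuronIdx₁ r o))
    (hh : ∀ i, NeuronsApprox σ (Set.univ.pi fun _ => K) η (h i) (lagParam z)
      fun r o => z (neuronIdx₂ i r o)) :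
    ∃ (w₀ : Fin M → ℝ) (w : (i : Fin d) → Fin (m i) → ℝ), ∀ x ∈ Set.univ.pi fun _ => K,
      ‖(g (Fin.init x) + ∑ i, h i (Fin.init x) * x (Fin.last n) i) -
        outputVec (n + 1) w₀ w ⬝ᵥ schemeDeltaRS σ z x‖ ≤ η * (1 + d * R) := by
  obtain ⟨w₀, hw₀⟩ := hg
  choose w hw using hh
  refine ⟨w₀, w, fun x hx => ?_⟩
  have init_mem : Fin.init x ∈ Set.univ.pi fun _ : Fin n => K := fun t _ => hx t.castSucc trivial
  rw [outputVec_dotProduct_schemeDeltaRS h0, add_sub_add_comm, ← Finset.sum_sub_distrib]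
  simp_rw [← sub_mul]
  calc _ ≤ η + ∑ _i : Fin d, η * R := by
        refine norm_add_le_of_le (hw₀ _ init_mem).le (norm_sum_le_of_le _ fun i _ => ?_)
        exact norm_mul_le_of_le (hw i _ init_mem).le
          ((norm_le_pi_norm _ i).trans (hR _ (hx (Fin.last n) trivial)))
    _ = η * (1 + d * R) := by
        simp only [Finset.sum_const, Finset.card_univ, Fintype.card_fin, nsmul_eq_mul]
        ring

end Sampling

end RandSig

open RandSig in
theorem mainTheorem2_general {d n : ℕ} (K : Set (Fin d → ℝ)) (hK : IsCompact K)
    (σ : ℝ → ℝ) (hσ : Continuous σ) (hbdd : ∃ C : ℝ, ∀ t, |σ t| ≤ C)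
    (hinj : Function.Injective σ) (h0 : σ 0 = 0)
    (μ : Measure ℝ) [IsProbabilityMeasure μ] [μ.IsOpenPosMeasure] (hμ : μ {0} = 0)
    (g : (Fin n → Fin d → ℝ) → ℝ) (hg : ContinuousOn g (Set.univ.pi fun _ => K))
    (h : Fin d → (Fin n → Fin d → ℝ) → ℝ)
    (hh : ∀ i, ContinuousOn (h i) (Set.univ.pi fun _ => K))
    (f : (Fin (n + 1) → Fin d → ℝ) → ℝ)
    (hf : ∀ x ∈ Set.univ.pi fun _ => K,
      f x = g (Fin.init x) + ∑ i, h i (Fin.init x) * x (Fin.last n) i)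
    (α : ℝ) (hα : α < 1) (ε : ℝ) (hε : 0 < ε) :
    ∃ (M : ℕ) (m : Fin d → ℕ), 0 < M ∧ (∀ i, 0 < m i) ∧
      ∀ (Ω : Type*) [MeasurableSpace Ω] (P : Measure Ω) [IsProbabilityMeasure P]
        (ζ : HiddenIdx n d M m → Ω → ℝ), IsSamplingScheme₂ P μ ζ →
        ∃ E : Set Ω, MeasurableSet E ∧ α < P.real E ∧
          ∀ ω ∈ E, ∃ (w₀ : Fin M → ℝ) (w : (i : Fin d) → Fin (m i) → ℝ),
            (⨆ x ∈ Set.univ.pi fun _ : Fin (n + 1) => K,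
              ‖f x - outputVec (n + 1) w₀ w ⬝ᵥ schemeDeltaRS σ (fun e => ζ e ω) x‖ₑ) <
                ENNReal.ofReal ε := by
  lift σ to C(ℝ, ℝ) using hσ
  obtain ⟨C, hC⟩ := hbdd
  obtain ⟨R, hRpos, hR⟩ := hK.isBounded.exists_pos_norm_le
  obtain ⟨M, m, hM, hm, rare⟩ := exists_widths_measure_not_neuronsApprox_lt hC hinj h0 μ hμ
    (isCompact_univ_pi fun _ => hK) (η := ε / 2 / (1 + d * R)) (by positivity) hg hh
    (ENNReal.ofReal_pos.2 (sub_pos.2 hα)).ne'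
  refine ⟨M, m, hM, hm, fun Ω _ P _ ζ hζ => ?_⟩
  obtain ⟨E, hE, hαE, disjoint⟩ := exists_measurableSet_lt_measureReal_disjoint (rare Ω P ζ hζ)
  refine ⟨E, hE, hαE, fun ω hω => ?_⟩
  obtain ⟨approx₀, approx⟩ := not_not.1 (Set.disjoint_left.1 disjoint hω)
  obtain ⟨w₀, w, error_le⟩ := exists_norm_sub_outputVec_dotProduct_le h0 hR approx₀ approx
  rw [div_mul_cancel₀ _ (by positivity)] at error_le
  refine ⟨w₀, w, lt_of_le_of_lt (iSup₂_le fun x hx => ?_)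
    ((ENNReal.ofReal_lt_ofReal_iff hε).2 (half_lt_self hε))⟩
  rw [← ofReal_norm, hf x hx]
  exact ENNReal.ofReal_le_ofReal (error_le x hx)

theorem mainTheorem2 {d n : ℕ} (K : Set (Fin d → ℝ)) (hK : IsCompact K)
    (σ : ℝ → ℝ) (hσ : RandSig.IsAdmissibleActivation σ)
    (μ : Measure ℝ) [IsProbabilityMeasure μ] [μ.IsOpenPosMeasure] (hμ : μ ≪ volume)
    (g : (Fin n → Fin d → ℝ) → ℝ) (hg : ContinuousOn g (Set.univ.pi fun _ => K))
    (h : Fin d → (Fin n → Fin d → ℝ) → ℝ)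
    (hh : ∀ i, ContinuousOn (h i) (Set.univ.pi fun _ => K))
    (f : (Fin (n + 1) → Fin d → ℝ) → ℝ)
    (hf : ∀ x ∈ Set.univ.pi fun _ => K,
      f x = g (Fin.init x) + ∑ i, h i (Fin.init x) * x (Fin.last n) i)
    (α : ℝ) (hα : α ∈ Set.Ioo (0 : ℝ) 1) (ε : ℝ) (hε : 0 < ε) :
    ∃ (M : ℕ) (m : Fin d → ℕ), 0 < M ∧ (∀ i, 0 < m i) ∧
      ∀ (Ω : Type*) [MeasurableSpace Ω] (P : Measure Ω) [IsProbabilityMeasure P]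
        (ζ : RandSig.HiddenIdx n d M m → Ω → ℝ), RandSig.IsSamplingScheme₂ P μ ζ →
        ∃ E : Set Ω, MeasurableSet E ∧ α < P.real E ∧
          ∀ ω ∈ E, ∃ (w₀ : Fin M → ℝ) (w : (i : Fin d) → Fin (m i) → ℝ),
            (⨆ x ∈ Set.univ.pi fun _ : Fin (n + 1) => K,
              ‖f x - RandSig.outputVec (n + 1) w₀ w ⬝ᵥ
                RandSig.schemeDeltaRS σ (fun e => ζ e ω) x‖ₑ) < ENNReal.ofReal ε :=
  mainTheorem2_general K hK σ hσ.continuous hσ.bounded hσ.injective hσ.map_zero μ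
    (hμ (by simp)) g hg h hh f hf α hα.2 ε hε
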